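/- Let $1\le p<\infty$, let $L^p[0,1]$ be the complex Banach space of (classes of) $p$-integrable functions on $[0,1]$ with Lebesgue measure, and for $t\in[0,1]$ let $\mathcal N_t=\{f\in L^p[0,1] : f\chi_{[t,1]}=0 \text{ a.e.}\}$. Let $\mathfrak N=\{\mathcal N_t : t\in[0,1]\}$ be the Volterra nest, and let $\mathrm{Col}(\mathfrak N)$ be the group, under composition, of its collineations, that is, of all invertible bounded linear operators $S$ on $L^p[0,1]$ such that a closed subspace $\mathcal M$ of $L^p[0,1]$ belongs to $\mathfrak N$ if and only if $S\mathcal M$ belongs to $\mathfrak N$. Let $\Delta$ be the group, under composition, of all increasing bijections $\varphi\colon[0,1]\to[0,1]$ such that $\varphi$ and $\varphi^{-1}$ are absolutely continuous. (i) For every $\varphi\in\Delta$, the formula $V_\varphi f=(\varphi')^{1/p}\,(f\circ\varphi)$ defines, independently of the chosen representative of $f$, a bijective linear isometry $V_\varphi$ of $L^p[0,1]$, whose inverse is $V_{\varphi^{-1}}$. (ii) For every $\varphi\in\Delta$ and $t\in[0,1]$, $V_\varphi\mathcal N_t=\mathcal N_{\varphi^{-1}(t)}$. (iii) For every $\varphi\in\Delta$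 the operator $V_\varphi$ belongs to $\mathrm{Col}(\mathfrak N)$, and the map $\omega\colon\varphi\mapsto V_\varphi$ is an injective anti-homomorphism from $\Delta$ into $\mathrm{Col}(\mathfrak N)$, that is, $V_{\varphi\circ\psi}=V_\psi V_\varphi$ for all $\varphi,\psi\in\Delta$, and $V_\varphi=V_\psi$ implies $\varphi=\psi$. -/

import Mathlib

open MeasureTheory unitInterval
open scoped ENNReal

/-! ### Collineations of a family of closed subspaces -/

/-- The group `Col(F)` of collineations of a family `F` of closed subspaces of a complex normed
space `X`: those invertible bounded operators `S` such that a closed subspace `M` belongs to `F`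
if and only if its image `S M` belongs to `F`. The ambient group of invertible operators has
composition as its product. -/
def collineationGroup {X : Type*} [NormedAddCommGroup X] [NormedSpace ℂ X]
    (F : Set (ClosedSubmodule ℂ X)) : Subgroup (X ≃L[ℂ] X) where
  carrier := {S | ∀ M : ClosedSubmodule ℂ X, M ∈ F ↔ M.mapEquiv S ∈ F}
  one_mem' := by
    intro M
    have h : M.mapEquiv (1 : X ≃L[ℂ] X) = M := by
      ext x
      exact ClosedSubmodule.mem_mapEquiv_iff (f := (1 : X ≃L[ℂ] X)) (s := M) x
    rw [h]
  mul_mem' := by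
    intro S T hS hT M
    have h : M.mapEquiv (S * T) = (M.mapEquiv T).mapEquiv S := by
      refine SetLike.ext fun x => ?_
      rw [ClosedSubmodule.mem_mapEquiv_iff, ClosedSubmodule.mem_mapEquiv_iff,
        ClosedSubmodule.mem_mapEquiv_iff]
      rfl
    rw [h, hT M, hS (M.mapEquiv T)]
  inv_mem' := by
    intro S hS M
    have h : (M.mapEquiv S⁻¹).mapEquiv S = M := by
      refine SetLike.ext fun x => ?_
      rw [ClosedSubmodule.mem_mapEquiv_iff, ClosedSubmodule.mem_mapEquiv_iff]
      change S (S.symm x) ∈ M ↔ x ∈ M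
      rw [S.apply_symm_apply]
    rw [hS (M.mapEquiv S⁻¹), h]

/-! ### The Volterra nest in `L^p[0,1]` -/

/-- The closed subspace `N_t` of all `f ∈ L^p[0,1]` such that `f χ_[t,1] = 0` almost everywhere. -/
noncomputable def volterraSubspace (p : ℝ≥0∞) [Fact (1 ≤ p)] (t : I) :
    ClosedSubmodule ℂ (Lp ℂ p (volume : Measure I)) where
  carrier := {f | (Set.Icc t 1).indicator (f : I → ℂ) =ᵐ[volume] 0}
  zero_mem' := by
    filter_upwards [Lp.coeFn_zero ℂ p (volume : Measure I)] with x hx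
    exact Set.indicator_apply_eq_zero.mpr fun _ => hx
  add_mem' := by
    intro f g hf hg
    filter_upwards [hf, hg, Lp.coeFn_add f g] with x h1 h2 h3
    refine Set.indicator_apply_eq_zero.mpr fun h => h3.trans ?_
    rw [Pi.add_apply, Set.indicator_apply_eq_zero.mp h1 h, Set.indicator_apply_eq_zero.mp h2 h,
      add_zero]
  smul_mem' := by
    intro c f hf
    filter_upwards [hf, Lp.coeFn_smul c f] with x h1 h2
    refine Set.indicator_apply_eq_zero.mpr fun h => h2.trans ?_
    rw [Pi.smul_apply, Set.indicator_apply_eq_zero.mp h1 h, smul_zero]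
  isClosed' := by
    have key : {f : Lp ℂ p (volume : Measure I) |
        (Set.Icc t 1).indicator (f : I → ℂ) =ᵐ[volume] 0} =
        (LpToLpRestrictCLM I ℂ ℂ volume p (Set.Icc t 1)) ⁻¹' {0} := by
      ext f
      have h1 := LpToLpRestrictCLM_coeFn (μ := (volume : Measure I)) (p := p) ℂ (Set.Icc t 1) f
      rw [Set.mem_preimage, Set.mem_singleton_iff, Lp.eq_zero_iff_ae_eq_zero]
      have h2 : (Set.Icc t 1).indicator (f : I → ℂ) =ᵐ[volume] 0 ↔
          (f : I → ℂ) =ᵐ[volume.restrict (Set.Icc t 1)] 0 := by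
        rw [Filter.EventuallyEq, Filter.EventuallyEq, ae_restrict_iff' measurableSet_Icc]
        exact Filter.eventually_congr (.of_forall fun x => Set.indicator_apply_eq_zero)
      exact h2.trans ⟨fun h => h1.trans h, fun h => h1.symm.trans h⟩
    change IsClosed {f : Lp ℂ p (volume : Measure I) |
        (Set.Icc t 1).indicator (f : I → ℂ) =ᵐ[volume] 0}
    rw [key]
    exact isClosed_singleton.preimage (LpToLpRestrictCLM I ℂ ℂ volume p (Set.Icc t 1)).continuous

/-- The Volterra nest `{N_t : t ∈ [0,1]}`. -/
noncomputable def volterraNest (p : ℝ≥0∞) [Fact (1 ≤ p)] :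
    Set (ClosedSubmodule ℂ (Lp ℂ p (volume : Measure I))) :=
  Set.range (volterraSubspace p)

/-! ### Bi-absolutely continuous increasing bijections of `[0,1]` -/

/-- The extension to the real line of an increasing bijection `φ` of `[0,1]`, constant on each side
of `[0,1]`. -/
noncomputable def extendToReal (φ : I ≃o I) : ℝ → ℝ :=
  Set.IccExtend zero_le_one fun x : I => (φ x : ℝ)

/-- Absolute continuity on `[0,1]` of an increasing bijection of `[0,1]`. -/
def IsAbsCont (φ : I ≃o I) : Prop :=
  AbsolutelyContinuousOnInterval (extendToReal φ) 0 1

theorem IsAbsCont.one : IsAbsCont 1 := by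
  have h : LipschitzWith 1 (extendToReal 1) := by
    refine LipschitzWith.of_dist_le_mul fun x y => ?_
    exact (LipschitzWith.projIcc (zero_le_one' ℝ)).dist_le_mul x y
  exact h.lipschitzOnWith.absolutelyContinuousOnInterval

theorem IsAbsCont.mul {φ ψ : I ≃o I} (hφ : IsAbsCont φ) (hψ : IsAbsCont ψ) :
    IsAbsCont (φ * ψ) := by
  have hmono : Monotone (extendToReal ψ) := by
    intro x y h
    exact ψ.monotone (Set.monotone_projIcc _ h)
  have hmem : ∀ x, extendToReal ψ x ∈ Set.uIcc (0 : ℝ) 1 := by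
    intro x
    rw [Set.uIcc_of_le zero_le_one]
    exact (ψ (Set.projIcc 0 1 zero_le_one x)).2
  have hcomp : ∀ x, extendToReal (φ * ψ) x = extendToReal φ (extendToReal ψ x) := by
    intro x
    simp [extendToReal, Set.IccExtend, RelIso.mul_apply]
  unfold IsAbsCont at *
  rw [absolutelyContinuousOnInterval_iff] at *
  intro ε hε
  obtain ⟨δ, hδ, H⟩ := hφ ε hε
  obtain ⟨η, hη, K⟩ := hψ δ hδ
  refine ⟨η, hη, fun E hE hlt => ?_⟩
  simp only [hcomp]
  refine H (E.1, fun i => (extendToReal ψ (E.2 i).1, extendToReal ψ (E.2 i).2)) ⟨fun i _ =>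
    ⟨hmem _, hmem _⟩, fun i hi j hj hij => ?_⟩ (K E hE hlt)
  have hd := hE.2 hi hj hij
  simp only [Function.onFun, Set.uIoc, Set.Ioc_disjoint_Ioc] at hd ⊢
  rw [← hmono.map_max, ← hmono.map_max, ← hmono.map_min, ← hmono.map_min, ← hmono.map_min,
    ← hmono.map_max]
  exact hmono hd

/-- The group `Δ` of all increasing bijections `φ` of `[0,1]` such that `φ` and `φ⁻¹` are
absolutely continuous. Its product is composition: `(φ * ψ) x = φ (ψ x)`. -/
def biAbsContGroup : Subgroup (I ≃o I) where
  carrier := {φ | IsAbsCont φ ∧ IsAbsCont φ⁻¹}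
  one_mem' := ⟨IsAbsCont.one, by rw [inv_one]; exact IsAbsCont.one⟩
  mul_mem' := by
    intro φ ψ hφ hψ
    exact ⟨hφ.1.mul hψ.1, by rw [mul_inv_rev]; exact hψ.2.mul hφ.2⟩
  inv_mem' := by
    intro φ hφ
    exact ⟨hφ.2, by rw [inv_inv]; exact hφ.1⟩

/-- The function `(φ')^{1/p} (g ∘ φ)` on `[0,1]`. An increasing bijection `φ` is differentiable at
almost every point of `[0,1]`; the values at the remaining points and at the endpoints, where the
derivative of the extension need not be the derivative of `φ`, do not matter. -/
noncomputable def weightedComp (p : ℝ≥0∞) (φ : I ≃o I) (g : I → ℂ) : I → ℂ :=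
  fun x => ((deriv (extendToReal φ) (x : ℝ) ^ (1 / p.toReal) : ℝ) : ℂ) * g (φ x)

/-! ### The extension of an increasing bijection and its derivative -/

/-! The two absolute continuity conditions play different roles. If `φ` is absolutely continuous, it
is the integral of `φ'`, so `φ` carries the measure `φ' dx` to Lebesgue measure
(`measurePreserving_derivMeasure`); this change of variables makes `V_φ` isometric. If `φ⁻¹` is
absolutely continuous, preimages of null sets under `φ` are null
(`quasiMeasurePreserving_of_isAbsCont_inv`); hence `f ∘ φ` does not depend on the representative.

The same nullity gives the chain rule almost everywhere, whence `V_{φψ} = V_ψ V_φ`, and surjectivity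
follows by taking `ψ = φ⁻¹`. Injectivity of `ω` holds because `V_φ 1` determines `φ'`, hence `φ`. -/

theorem extendToReal_coe (φ : I ≃o I) (x : I) : extendToReal φ x = φ x :=
  Set.IccExtend_val _ _ x

theorem monotone_extendToReal (φ : I ≃o I) : Monotone (extendToReal φ) :=
  fun _ _ h => φ.monotone (Set.monotone_projIcc _ h)

theorem extendToReal_mul (φ ψ : I ≃o I) :
    extendToReal (φ * ψ) = extendToReal φ ∘ extendToReal ψ := by
  funext x
  simp [extendToReal, Set.IccExtend, RelIso.mul_apply]

theorem deriv_extendToReal_nonneg (φ : I ≃o I) (x : ℝ) : 0 ≤ deriv (extendToReal φ) x :=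
  (monotone_extendToReal φ).deriv_nonneg

theorem measurable_deriv_extendToReal (φ : I ≃o I) :
    Measurable fun x : I => deriv (extendToReal φ) (x : ℝ) :=
  (measurable_deriv _).comp measurable_subtype_coe

/-- A property of almost all real numbers holds at almost all points of the unit interval. -/
theorem ae_unitInterval_of_ae {P : ℝ → Prop} (h : ∀ᵐ x, P x) : ∀ᵐ x : I, P x :=
  measurePreserving_coe.quasiMeasurePreserving.ae (ae_restrict_of_ae h)

theorem ae_differentiableAt_extendToReal (φ : I ≃o I) :
    ∀ᵐ x : I, DifferentiableAt ℝ (extendToReal φ) (x : ℝ) :=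
  ae_unitInterval_of_ae (monotone_extendToReal φ).ae_differentiableAt

theorem ae_deriv_extendToReal_one : ∀ᵐ x : I, deriv (extendToReal 1) (x : ℝ) = 1 := by
  -- The extension of the identity has corners at 0 and 1, where `deriv` takes its default value 0;
  -- these two points are discarded.
  have h : ∀ᵐ x : ℝ, x ∈ Set.Icc (0 : ℝ) 1 → x ∈ Set.Ioo (0 : ℝ) 1 := by
    filter_upwards [Measure.ae_ne volume (0 : ℝ), Measure.ae_ne volume (1 : ℝ)] with x h0 h1 hx
    exact ⟨lt_of_le_of_ne hx.1 h0.symm, lt_of_le_of_ne hx.2 h1⟩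
  filter_upwards [ae_unitInterval_of_ae h] with x hx
  have heq : extendToReal 1 =ᶠ[nhds (x : ℝ)] id := by
    filter_upwards [isOpen_Ioo.mem_nhds (hx x.2)] with y hy
    exact extendToReal_coe 1 ⟨y, Set.Ioo_subset_Icc_self hy⟩
  rw [heq.deriv_eq, deriv_id]

/-! ### Change of variables -/

/-- The measure on `[0,1]` with density `φ'`. -/
noncomputable def derivMeasure (φ : I ≃o I) : Measure I :=
  volume.withDensity fun x : I => ENNReal.ofReal (deriv (extendToReal φ) (x : ℝ))

/-- The fundamental theorem of calculus for absolutely continuous functions, with `φ 0 = 0`. -/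
theorem derivMeasure_Iic {φ : I ≃o I} (hφ : IsAbsCont φ) (b : I) :
    derivMeasure φ (Set.Iic b) = ENNReal.ofReal (φ b) := by
  have hac : AbsolutelyContinuousOnInterval (extendToReal φ) 0 b :=
    hφ.mono (Set.uIcc_subset_uIcc_left (by
      rw [Set.uIcc_of_le zero_le_one]
      exact b.2))
  have hint := hac.intervalIntegrable_deriv
  have h := hac.integral_deriv_eq_sub
  have h0 : extendToReal φ 0 = 0 := by
    have h := extendToReal_coe φ 0
    rwa [show φ 0 = 0 from φ.map_bot] at h
  rw [extendToReal_coe, h0, sub_zero, intervalIntegral.integral_of_le b.2.1] at h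
  rw [intervalIntegrable_iff_integrableOn_Ioc_of_le b.2.1] at hint
  rw [derivMeasure, withDensity_apply _ measurableSet_Iic, volume_def,
    setLIntegral_subtype measurableSet_Icc (Set.Iic b)
      (fun x : ℝ => ENNReal.ofReal (deriv (extendToReal φ) x)),
    Set.image_subtype_val_Icc_Iic, ← h, ofReal_integral_eq_lintegral_ofReal hint
      (.of_forall fun x => deriv_extendToReal_nonneg φ x)]
  exact setLIntegral_congr Ioc_ae_eq_Icc.symm

theorem measurePreserving_derivMeasure {φ : I ≃o I} (hφ : IsAbsCont φ) :
    MeasurePreserving φ (derivMeasure φ) volume := by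
  have hm : Measurable φ := φ.continuous.measurable
  refine ⟨hm, (Measure.ext_of_Iic _ _ fun a => ?_).symm⟩
  have hpre : φ ⁻¹' Set.Iic a = Set.Iic (φ.symm a) := by
    ext x
    simp [φ.le_symm_apply]
  rw [Measure.map_apply hm measurableSet_Iic, hpre, derivMeasure_Iic hφ, volume_Iic,
    φ.apply_symm_apply]

/-- Lebesgue measure is the image of `derivMeasure φ⁻¹` under `φ⁻¹`; pushing it forward by `φ`
therefore returns `derivMeasure φ⁻¹`, which has a density. -/
theorem quasiMeasurePreserving_of_isAbsCont_inv {φ : I ≃o I} (hφ : IsAbsCont φ⁻¹) :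
    Measure.QuasiMeasurePreserving φ (volume : Measure I) volume := by
  have hm : Measurable φ := φ.continuous.measurable
  refine ⟨hm, ?_⟩
  have hmap : Measure.map φ volume = derivMeasure φ⁻¹ := by
    have h := measurePreserving_derivMeasure hφ
    conv_lhs => rw [← h.map_eq]
    rw [Measure.map_map hm h.measurable]
    have hid : (φ : I → I) ∘ (φ⁻¹ : I ≃o I) = id := by
      funext x
      exact φ.apply_symm_apply x
    rw [hid, Measure.map_id]
  rw [hmap]
  exact withDensity_absolutelyContinuous _ _

/-- The chain rule can fail at points that `ψ` sends to non-differentiability points of `φ`. Those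
points form a null set, and so does their preimage under `ψ`. -/
theorem ae_deriv_extendToReal_mul (φ : I ≃o I) {ψ : I ≃o I} (hψ : IsAbsCont ψ⁻¹) :
    ∀ᵐ x : I, deriv (extendToReal (φ * ψ)) (x : ℝ) =
      deriv (extendToReal φ) (ψ x : ℝ) * deriv (extendToReal ψ) (x : ℝ) := by
  filter_upwards [ae_differentiableAt_extendToReal ψ,
    (quasiMeasurePreserving_of_isAbsCont_inv hψ).ae (ae_differentiableAt_extendToReal φ)]
    with x h1 h2
  rw [← extendToReal_coe ψ] at h2 ⊢
  rw [extendToReal_mul, deriv_comp _ h2 h1]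

theorem eq_of_ae_deriv_extendToReal_eq {φ ψ : I ≃o I} (hφ : IsAbsCont φ) (hψ : IsAbsCont ψ)
    (h : ∀ᵐ x : I, deriv (extendToReal φ) (x : ℝ) = deriv (extendToReal ψ) (x : ℝ)) :
    φ = ψ := by
  have hμ : derivMeasure φ = derivMeasure ψ :=
    withDensity_congr_ae (h.mono fun _ hx => congrArg ENNReal.ofReal hx)
  ext x
  have hx := derivMeasure_Iic hφ x
  rw [hμ, derivMeasure_Iic hψ] at hx
  exact ((ENNReal.ofReal_eq_ofReal_iff (ψ x).2.1 (φ x).2.1).mp hx).symm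

/-! ### The weighted composition operator on functions -/

section WeightedComp

variable {p : ℝ≥0∞} {φ ψ : I ≃o I} {g h : I → ℂ}

theorem weightedComp_congr_ae (hφ : IsAbsCont φ⁻¹) (hgh : g =ᵐ[volume] h) :
    weightedComp p φ g =ᵐ[volume] weightedComp p φ h := by
  filter_upwards [(quasiMeasurePreserving_of_isAbsCont_inv hφ).ae hgh] with x hx
  rw [weightedComp, weightedComp, hx]

theorem weightedComp_one_ae (g : I → ℂ) : weightedComp p 1 g =ᵐ[volume] g := by
  filter_upwards [ae_deriv_extendToReal_one] with x hx
  rw [weightedComp, hx]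
  simp

theorem weightedComp_weightedComp_ae (hψ : IsAbsCont ψ⁻¹) (g : I → ℂ) :
    weightedComp p ψ (weightedComp p φ g) =ᵐ[volume] weightedComp p (φ * ψ) g := by
  filter_upwards [ae_deriv_extendToReal_mul φ hψ] with x hx
  simp only [weightedComp, hx, RelIso.mul_apply]
  rw [Real.mul_rpow (deriv_extendToReal_nonneg _ _) (deriv_extendToReal_nonneg _ _)]
  push_cast
  ring

theorem aestronglyMeasurable_weightedComp (hφ : IsAbsCont φ⁻¹)
    (hg : AEStronglyMeasurable g volume) :
    AEStronglyMeasurable (weightedComp p φ g) volume := by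
  have h : Measurable fun x : I =>
      ((deriv (extendToReal φ) (x : ℝ) ^ (1 / p.toReal) : ℝ) : ℂ) :=
    Complex.measurable_ofReal.comp ((measurable_deriv_extendToReal φ).pow_const _)
  exact h.aestronglyMeasurable.mul
    (hg.comp_quasiMeasurePreserving (quasiMeasurePreserving_of_isAbsCont_inv hφ))

/-- The `p`-th power of the weight is `φ'`, the density in the change of variables by `φ`. -/
theorem eLpNorm_weightedComp (hp0 : p ≠ 0) (hp : p ≠ ∞) (hφ : IsAbsCont φ)
    (hg : AEStronglyMeasurable g volume) :
    eLpNorm (weightedComp p φ g) p volume = eLpNorm g p volume := by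
  have hpr : 0 < p.toReal := ENNReal.toReal_pos hp0 hp
  rw [eLpNorm_eq_lintegral_rpow_enorm_toReal hp0 hp, eLpNorm_eq_lintegral_rpow_enorm_toReal hp0 hp]
  congr 1
  have hmp := measurePreserving_derivMeasure hφ
  have hmeas : AEMeasurable (fun x => ‖g x‖ₑ ^ p.toReal) volume := hg.enorm.pow_const _
  rw [← hmp.map_eq] at hmeas
  have hcov : ∫⁻ x, ‖g x‖ₑ ^ p.toReal = ∫⁻ x, ‖g (φ x)‖ₑ ^ p.toReal ∂derivMeasure φ := by
    conv_lhs => rw [← hmp.map_eq]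
    exact lintegral_map' hmeas hmp.measurable.aemeasurable
  have hD : Measurable fun x : I => ENNReal.ofReal (deriv (extendToReal φ) (x : ℝ)) :=
    (measurable_deriv_extendToReal φ).ennreal_ofReal
  rw [hcov]
  refine Eq.trans ?_ (lintegral_withDensity_eq_lintegral_mul₀' hD.aemeasurable
    (hmeas.comp_measurable hmp.measurable)).symm
  refine lintegral_congr fun x => ?_
  have h0 := deriv_extendToReal_nonneg φ x
  rw [weightedComp, enorm_mul, ENNReal.mul_rpow_of_nonneg _ _ hpr.le, ← ofReal_norm,
    Complex.norm_real, Real.norm_of_nonneg (Real.rpow_nonneg h0 _),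
    ENNReal.ofReal_rpow_of_nonneg (Real.rpow_nonneg h0 _) hpr.le, ← Real.rpow_mul h0,
    one_div_mul_cancel hpr.ne', Real.rpow_one]
  rfl

theorem weightedComp_ae_eq_zero_on_Icc (hφ : IsAbsCont φ⁻¹) {t : I}
    (hg : (Set.Icc t 1).indicator g =ᵐ[volume] 0) :
    (Set.Icc (φ.symm t) 1).indicator (weightedComp p φ g) =ᵐ[volume] 0 := by
  filter_upwards [(quasiMeasurePreserving_of_isAbsCont_inv hφ).ae hg] with x hx
  refine Set.indicator_apply_eq_zero.mpr fun h => ?_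
  have hx0 := Set.indicator_apply_eq_zero.mp hx ⟨φ.symm_apply_le.mp h.1, le_one'⟩
  rw [weightedComp, hx0]
  exact mul_zero _

end WeightedComp

/-! ### The weighted composition operator on `L^p` -/

section Operator

variable {p : ℝ≥0∞} [Fact (1 ≤ p)]

theorem memLp_weightedComp (hp : p ≠ ∞) (φ : biAbsContGroup)
    (f : Lp ℂ p (volume : Measure I)) : MemLp (weightedComp p φ f) p volume :=
  ⟨aestronglyMeasurable_weightedComp φ.2.2 (Lp.aestronglyMeasurable f), by
    rw [eLpNorm_weightedComp (zero_lt_one.trans_le Fact.out).ne' hp φ.2.1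
      (Lp.aestronglyMeasurable f)]
    exact Lp.eLpNorm_lt_top f⟩

/-- The linear isometry of `L^p[0,1]` induced by `g ↦ (φ')^{1/p} (g ∘ φ)`. -/
noncomputable def weightedCompLI (hp : p ≠ ∞) (φ : biAbsContGroup) :
    Lp ℂ p (volume : Measure I) →ₗᵢ[ℂ] Lp ℂ p (volume : Measure I) where
  toFun f := (memLp_weightedComp hp φ f).toLp
  map_add' f g := by
    refine Lp.ext ((MemLp.coeFn_toLp _).trans ?_)
    filter_upwards [weightedComp_congr_ae (p := p) φ.2.2 (Lp.coeFn_add f g),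
      Lp.coeFn_add (memLp_weightedComp hp φ f).toLp (memLp_weightedComp hp φ g).toLp,
      (memLp_weightedComp hp φ f).coeFn_toLp, (memLp_weightedComp hp φ g).coeFn_toLp]
      with x h1 h2 h3 h4
    rw [h1, h2, Pi.add_apply, h3, h4]
    exact mul_add _ _ _
  map_smul' c f := by
    refine Lp.ext ((MemLp.coeFn_toLp _).trans ?_)
    filter_upwards [weightedComp_congr_ae (p := p) φ.2.2 (Lp.coeFn_smul c f),
      Lp.coeFn_smul c (memLp_weightedComp hp φ f).toLp,
      (memLp_weightedComp hp φ f).coeFn_toLp] with x h1 h2 h3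
    rw [h1, RingHom.id_apply, h2, Pi.smul_apply, h3]
    exact mul_left_comm _ _ _
  norm_map' f := by
    change ‖(memLp_weightedComp hp φ f).toLp‖ = ‖f‖
    rw [Lp.norm_toLp, eLpNorm_weightedComp (zero_lt_one.trans_le Fact.out).ne' hp φ.2.1
      (Lp.aestronglyMeasurable f), Lp.norm_def]

variable (hp : p ≠ ∞)

theorem weightedCompLI_ae_eq (φ : biAbsContGroup) {f : Lp ℂ p (volume : Measure I)} {g : I → ℂ}
    (hfg : f =ᵐ[volume] g) : weightedCompLI hp φ f =ᵐ[volume] weightedComp p φ g :=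
  (MemLp.coeFn_toLp (memLp_weightedComp hp φ f)).trans (weightedComp_congr_ae φ.2.2 hfg)

theorem weightedCompLI_mul (φ ψ : biAbsContGroup) (f : Lp ℂ p (volume : Measure I)) :
    weightedCompLI hp (φ * ψ) f = weightedCompLI hp ψ (weightedCompLI hp φ f) := by
  refine Lp.ext ((weightedCompLI_ae_eq hp _ .rfl).trans ?_)
  exact (weightedComp_weightedComp_ae ψ.2.2 f).symm.trans
    (weightedCompLI_ae_eq hp ψ (weightedCompLI_ae_eq hp φ .rfl)).symm

theorem weightedCompLI_one (f : Lp ℂ p (volume : Measure I)) : weightedCompLI hp 1 f = f :=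
  Lp.ext ((weightedCompLI_ae_eq hp 1 .rfl).trans (weightedComp_one_ae f))

theorem weightedCompLI_inv_apply (φ : biAbsContGroup) (f : Lp ℂ p (volume : Measure I)) :
    weightedCompLI hp φ⁻¹ (weightedCompLI hp φ f) = f := by
  rw [← weightedCompLI_mul, mul_inv_cancel, weightedCompLI_one]

theorem weightedCompLI_apply_inv (φ : biAbsContGroup) (f : Lp ℂ p (volume : Measure I)) :
    weightedCompLI hp φ (weightedCompLI hp φ⁻¹ f) = f := by
  rw [← weightedCompLI_mul, inv_mul_cancel, weightedCompLI_one]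

/-- The isometric automorphism of `L^p[0,1]` induced by `g ↦ (φ')^{1/p} (g ∘ φ)`. -/
noncomputable def weightedCompLIE (φ : biAbsContGroup) :
    Lp ℂ p (volume : Measure I) ≃ₗᵢ[ℂ] Lp ℂ p (volume : Measure I) where
  toFun := weightedCompLI hp φ
  invFun := weightedCompLI hp φ⁻¹
  left_inv := weightedCompLI_inv_apply hp φ
  right_inv := weightedCompLI_apply_inv hp φ
  map_add' := map_add _
  map_smul' := map_smul _
  norm_map' := (weightedCompLI hp φ).norm_map

theorem weightedCompLIE_symm (φ : biAbsContGroup) :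
    (weightedCompLIE hp φ).symm = weightedCompLIE hp φ⁻¹ :=
  LinearIsometryEquiv.ext fun _ => rfl

theorem weightedCompLI_mem_volterraSubspace (φ : biAbsContGroup) {t : I}
    {f : Lp ℂ p (volume : Measure I)} (hf : f ∈ volterraSubspace p t) :
    weightedCompLI hp φ f ∈ volterraSubspace p ((φ : I ≃o I).symm t) := by
  have h := weightedComp_ae_eq_zero_on_Icc (p := p) φ.2.2 hf
  change Set.indicator _ _ =ᵐ[volume] 0
  filter_upwards [h, weightedCompLI_ae_eq hp φ (f := f) .rfl] with x h1 h2
  exact Set.indicator_apply_eq_zero.mpr fun hx =>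
    h2.trans (Set.indicator_apply_eq_zero.mp h1 hx)

/-- One inclusion for `φ` and the same inclusion for `φ⁻¹` together give equality. -/
theorem mapEquiv_weightedCompLIE_volterraSubspace (φ : biAbsContGroup) (t : I) :
    (volterraSubspace p t).mapEquiv (weightedCompLIE hp φ).toContinuousLinearEquiv =
      volterraSubspace p ((φ : I ≃o I).symm t) := by
  refine SetLike.ext fun f => ?_
  rw [ClosedSubmodule.mem_mapEquiv_iff]
  change weightedCompLI hp φ⁻¹ f ∈ volterraSubspace p t ↔ _
  constructor
  · intro h
    have h1 := weightedCompLI_mem_volterraSubspace hp φ h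
    rwa [weightedCompLI_apply_inv] at h1
  · intro h
    have h1 := weightedCompLI_mem_volterraSubspace hp φ⁻¹ h
    rwa [show ((φ⁻¹ : biAbsContGroup) : I ≃o I).symm ((φ : I ≃o I).symm t) = t from
      (φ : I ≃o I).apply_symm_apply t] at h1

theorem weightedCompLIE_mem_collineationGroup (φ : biAbsContGroup) :
    (weightedCompLIE hp φ).toContinuousLinearEquiv ∈ collineationGroup (volterraNest p) := by
  have key : ∀ (ψ : biAbsContGroup) (M : ClosedSubmodule ℂ (Lp ℂ p (volume : Measure I))),
      M ∈ volterraNest p →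
        M.mapEquiv (weightedCompLIE hp ψ).toContinuousLinearEquiv ∈ volterraNest p := by
    rintro ψ M ⟨t, rfl⟩
    exact ⟨_, (mapEquiv_weightedCompLIE_volterraSubspace hp ψ t).symm⟩
  intro M
  refine ⟨key φ M, fun hM => ?_⟩
  -- The converse is the forward implication for `φ⁻¹`, applied to the image of `M`.
  have h : (M.mapEquiv (weightedCompLIE hp φ).toContinuousLinearEquiv).mapEquiv
      (weightedCompLIE hp φ⁻¹).toContinuousLinearEquiv = M := by
    refine SetLike.ext fun f => ?_
    rw [ClosedSubmodule.mem_mapEquiv_iff, ClosedSubmodule.mem_mapEquiv_iff]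
    change weightedCompLI hp φ⁻¹ (weightedCompLI hp φ⁻¹⁻¹ f) ∈ M ↔ f ∈ M
    rw [weightedCompLI_apply_inv]
  rw [← h]
  exact key φ⁻¹ _ hM

/-- Testing on the constant 1 recovers `(φ')^{1/p}`, and `1/p ≠ 0` since `p` is finite. -/
theorem weightedCompLI_injective {φ ψ : biAbsContGroup}
    (h : weightedCompLI (p := p) hp φ = weightedCompLI hp ψ) : φ = ψ := by
  have hpr : 0 < p.toReal := ENNReal.toReal_pos (zero_lt_one.trans_le Fact.out).ne' hp
  have hone : MemLp (fun _ : I => (1 : ℂ)) p volume := memLp_const 1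
  refine Subtype.ext (eq_of_ae_deriv_extendToReal_eq φ.2.1 ψ.2.1 ?_)
  have h1 := weightedCompLI_ae_eq hp φ hone.coeFn_toLp
  rw [h] at h1
  filter_upwards [h1, weightedCompLI_ae_eq hp ψ hone.coeFn_toLp] with x hx hy
  rw [hx] at hy
  simp only [weightedComp, mul_one, Complex.ofReal_inj] at hy
  exact (Real.rpow_left_inj (deriv_extendToReal_nonneg _ _) (deriv_extendToReal_nonneg _ _)
    (one_div_pos.mpr hpr).ne').mp hy

/-- The anti-homomorphism from the group of bi-absolutely continuous increasing bijections of
`[0,1]` into the group of collineations of the Volterra nest. -/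
noncomputable def weightedCompHom :
    biAbsContGroupᵐᵒᵖ →* collineationGroup (volterraNest p) where
  toFun φ := ⟨(weightedCompLIE hp φ.unop).toContinuousLinearEquiv,
    weightedCompLIE_mem_collineationGroup hp φ.unop⟩
  map_one' := Subtype.ext (ContinuousLinearEquiv.ext (funext fun f => weightedCompLI_one hp f))
  -- The product in the opposite group unwraps to `ψ.unop * φ.unop`, which undoes the reversal of
  -- order.
  map_mul' φ ψ := Subtype.ext (ContinuousLinearEquiv.ext
    (funext fun f => weightedCompLI_mul hp ψ.unop φ.unop f))

theorem weightedCompHom_injective : Function.Injective (weightedCompHom (p := p) hp) := by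
  intro φ ψ h
  refine MulOpposite.unop_injective (weightedCompLI_injective hp (LinearIsometry.ext fun f => ?_))
  exact DFunLike.congr_fun (congrArg Subtype.val h) f

end Operator

theorem proposition5p10 (p : ℝ≥0∞) [Fact (1 ≤ p)] (hp : p ≠ ∞) :
    ∃ V : biAbsContGroup → (Lp ℂ p (volume : Measure I) ≃ₗᵢ[ℂ] Lp ℂ p (volume : Measure I)),
      -- `V φ` is induced by `g ↦ (φ')^{1/p} (g ∘ φ)`, whichever representative `g` of `f` is used
      (∀ (φ : biAbsContGroup) (f : Lp ℂ p (volume : Measure I)) (g : I → ℂ),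
        f =ᵐ[volume] g → V φ f =ᵐ[volume] weightedComp p φ g) ∧
      -- the inverse of `V φ` is `V φ⁻¹`
      (∀ φ : biAbsContGroup, (V φ).symm = V φ⁻¹) ∧
      -- `V φ` maps `N_t` onto `N_{φ⁻¹(t)}`
      (∀ (φ : biAbsContGroup) (t : I),
        (volterraSubspace p t).mapEquiv (V φ).toContinuousLinearEquiv =
          volterraSubspace p ((φ : I ≃o I).symm t)) ∧
      -- `φ ↦ V φ` is an injective anti-homomorphism into the group of collineations
      ∃ ω : biAbsContGroupᵐᵒᵖ →* collineationGroup (volterraNest p),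
        Function.Injective ω ∧
        ∀ φ : biAbsContGroup, (ω (MulOpposite.op φ) :
          Lp ℂ p (volume : Measure I) ≃L[ℂ] Lp ℂ p (volume : Measure I)) =
            (V φ).toContinuousLinearEquiv := by
  exact ⟨weightedCompLIE hp, fun φ f g h => weightedCompLI_ae_eq hp φ h, weightedCompLIE_symm hp,
    mapEquiv_weightedCompLIE_volterraSubspace hp, weightedCompHom hp, weightedCompHom_injective hp,
    fun φ => rfl⟩
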